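/- Let $L$ be a continuous domain, i.e. a continuous dcpo (a bottom element is not required), and let $\Sigma L$ be $L$ with its Scott topology. Directed sets are nonempty, and a directed set $D$ converges to $x$, written $D\to x$, if $D$ meets every Scott open set containing $x$. Let $\mathcal{U}L$ be the directed upper powerspace of $\Sigma L$, in the following representation. Its points are the sets $\uparrow F$ with $F\subseteq L$ nonempty and finite, ordered by $\uparrow F_1\le_U\;\uparrow F_2\iff\;\uparrow F_2\subseteq\;\uparrow F_1$. For a family $\mathcal{F}$ of points that is directed for $\le_U$, write $\mathcal{F}\Rightarrow_U\;\uparrow F$ if there are finitely many directed sets $D_1,\dots,D_n\subseteq L$ such that: each $D_i$ converges to some element of $F$; each element of $F$ is a limit of some $D_i$; and for all $(d_1,\dots,d_n)\in\prod_i D_i$ there is $A\in\mathcal{F}$ with $A\subseteq\bigcup_{i}\uparrow d_i$. A set $\mathcal{V}$ of points is open in $\mathcal{U}L$ iff $\mathcal{F}\Rightarrow_U\;\uparrow F\in\mathcal{V}$ always implies $\mathcal{F}\cap\mathcal{V}\neq\emptyset$. For a $T_0$ space $X$, let $\Gamma(X)$ be the set of nonempty closed subsets of $X$, ordered by inclusion,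 and let $\widetilde{X}$ be the (standard representation of the) D-completion of $X$, ordered by inclusion: the smallest subset of $\Gamma(X)$ that contains all point closures $\overline{\{x\}}$, $x\in X$, and is closed under all existing suprema in $\Gamma(X)$ of directed subsets. Let $\mathcal{Q}(L)$ be the set of nonempty compact saturated subsets of $\Sigma L$, ordered by reverse inclusion, and for $K\in\mathcal{Q}(L)$ put $\mathcal{F}_K=\{\uparrow F : F\subseteq L \text{ nonempty and finite},\ K\subseteq\;\uparrow F\}$. Then $$\widetilde{\mathcal{U}L}=\{\mathcal{F}_K : K\in\mathcal{Q}(L)\},$$ and $K\mapsto\mathcal{F}_K$ is an order isomorphism from $\mathcal{Q}(L)$ onto $\widetilde{\mathcal{U}L}$. -/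

import Mathlib

open Set

namespace DirSpace

section Order

/-- A poset is a dcpo if every (nonempty) directed subset has a supremum. -/
def IsDcpo (L : Type*) [PartialOrder L] : Prop :=
  ∀ D : Set L, D.Nonempty → DirectedOn (· ≤ ·) D → ∃ a, IsLUB D a

/-- The way-below relation of a poset. -/
def WayBelow {L : Type*} [PartialOrder L] (x y : L) : Prop :=
  ∀ D : Set L, D.Nonempty → DirectedOn (· ≤ ·) D → ∀ a, IsLUB D a → y ≤ a → ∃ d ∈ D, x ≤ d

/-- A continuous domain: a dcpo in which, for each `x`, the elements way below `x` form a
(nonempty) directed set with supremum `x`. -/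
structure IsContinuousDomain (L : Type*) [PartialOrder L] : Prop where
  isDcpo : IsDcpo L
  nonempty (x : L) : {y | WayBelow y x}.Nonempty
  directedOn (x : L) : DirectedOn (· ≤ ·) {y | WayBelow y x}
  isLUB (x : L) : IsLUB {y | WayBelow y x} x

end Order

section Space

variable {X : Type*} [TopologicalSpace X]

/-- The specialization order of a space: `x ⊑ y` iff `x` lies in the closure of `{y}`. -/
def SpecLE (x y : X) : Prop := x ∈ closure {y}

/-- The upper set `↑F` generated by `F`, with respect to the specialization order. -/
def up (F : Set X) : Set X := {y | ∃ x ∈ F, SpecLE x y}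

/-- `D` is a (nonempty) directed subset, with respect to the specialization order. -/
def IsDirected (D : Set X) : Prop := D.Nonempty ∧ DirectedOn SpecLE D

/-- The set `lim D` of all limits of a directed subset `D`, regarded as a monotone net. -/
def dlim (D : Set X) : Set X := {x | ∀ U : Set X, IsOpen U → x ∈ U → (D ∩ U).Nonempty}

/-- The carrier `{↑F : F ⊆ X nonempty and finite}` of the directed upper powerspace. -/
def UpperPowerspace (X : Type*) [TopologicalSpace X] : Type _ :=
  {A : Set X // ∃ F : Set X, F.Finite ∧ F.Nonempty ∧ A = up F}

/-- The order on the carrier is reverse inclusion. -/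
instance : PartialOrder (UpperPowerspace X) where
  le A B := B.1 ⊆ A.1
  le_refl _ := Subset.rfl
  le_trans _ _ _ h₁ h₂ := h₂.trans h₁
  le_antisymm _ _ h₁ h₂ := Subtype.ext (Subset.antisymm h₂ h₁)

/-- The element `↑F` of the upper powerspace. -/
def upElt (F : Set X) (hf : F.Finite) (hne : F.Nonempty) : UpperPowerspace X :=
  ⟨up F, F, hf, hne, rfl⟩

/-- The convergence `𝓕 ⇒ ↑F` of a family `𝓕` of elements of the upper powerspace: there are finitely
many directed sets `D₁, …, Dₙ` of `X`, each with a limit in `F`, whose limits cover `F`, such that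
for every choice of `dᵢ ∈ Dᵢ` some member of `𝓕` is contained in `↑d₁ ∪ … ∪ ↑dₙ`. -/
def UConv (𝓕 : Set (UpperPowerspace X)) (F : Set X) : Prop :=
  ∃ (n : ℕ) (D : Fin n → Set X),
    (∀ i, IsDirected (D i)) ∧
    (∀ i, (F ∩ dlim (D i)).Nonempty) ∧
    F ⊆ ⋃ i, dlim (D i) ∧
    ∀ d : Fin n → X, (∀ i, d i ∈ D i) → ∃ A ∈ 𝓕, A.1 ⊆ ⋃ i, up {d i}

/-- The convergence open subsets of the upper powerspace. -/
def UOpen (𝓥 : Set (UpperPowerspace X)) : Prop :=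
  ∀ 𝓕 : Set (UpperPowerspace X), 𝓕.Nonempty → DirectedOn (· ≤ ·) 𝓕 →
    ∀ (F : Set X) (hf : F.Finite) (hne : F.Nonempty),
      UConv 𝓕 F → upElt F hf hne ∈ 𝓥 → (𝓕 ∩ 𝓥).Nonempty

lemma specLE_refl (x : X) : SpecLE x x := subset_closure rfl

lemma specLE_iff {x y : X} : SpecLE x y ↔ ∀ U : Set X, IsOpen U → x ∈ U → y ∈ U := by
  simp only [SpecLE, mem_closure_iff, inter_singleton_nonempty]

lemma UOpen.mem_of_le {𝓥 : Set (UpperPowerspace X)} (h : UOpen 𝓥) {A B : UpperPowerspace X}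
    (hAB : A ≤ B) (hA : A ∈ 𝓥) : B ∈ 𝓥 := by
  obtain ⟨_, F, hf, hne, rfl⟩ := A
  have key : UConv {B} F := by
    have := hf.to_subtype
    obtain ⟨n, ⟨e⟩⟩ := Finite.exists_equiv_fin F
    refine ⟨n, fun i => {(e.symm i : X)}, fun i => ⟨singleton_nonempty _, ?_⟩, fun i => ?_, ?_, ?_⟩
    · rintro x rfl y rfl
      exact ⟨_, rfl, specLE_refl _, specLE_refl _⟩
    · exact ⟨_, (e.symm i).2, fun U _ hx => ⟨_, rfl, hx⟩⟩
    · intro x hx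
      refine mem_iUnion.2 ⟨e ⟨x, hx⟩, fun U _ hxU => ⟨x, by simp, hxU⟩⟩
    · intro d hd
      refine ⟨B, rfl, fun y hy => ?_⟩
      obtain ⟨x, hx, hxy⟩ := hAB hy
      refine mem_iUnion.2 ⟨e ⟨x, hx⟩, x, ?_, hxy⟩
      have := hd (e ⟨x, hx⟩)
      simpa using this.symm
  obtain ⟨C, hC, hCV⟩ := h {B} (singleton_nonempty B)
    (by rintro x rfl y rfl; exact ⟨_, rfl, le_rfl, le_rfl⟩) F hf hne key hA
  rw [mem_singleton_iff] at hC
  exact hC ▸ hCV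

/-- The topology of the directed upper powerspace: all convergence open sets. -/
instance : TopologicalSpace (UpperPowerspace X) where
  IsOpen := UOpen
  isOpen_univ _ h _ _ _ _ _ _ := by simpa using h
  isOpen_inter s t hs ht 𝓕 h₁ h₂ F hf hne hc hF := by
    obtain ⟨A, hA, hAs⟩ := hs 𝓕 h₁ h₂ F hf hne hc hF.1
    obtain ⟨B, hB, hBt⟩ := ht 𝓕 h₁ h₂ F hf hne hc hF.2
    obtain ⟨C, hC, hAC, hBC⟩ := h₂ A hA B hB
    exact ⟨C, hC, hs.mem_of_le hAC hAs, ht.mem_of_le hBC hBt⟩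
  isOpen_sUnion S hS 𝓕 h₁ h₂ F hf hne hc := by
    rintro ⟨s, hs, hFs⟩
    obtain ⟨A, hA, hAs⟩ := hS s hs 𝓕 h₁ h₂ F hf hne hc hFs
    exact ⟨A, hA, s, hs, hAs⟩

/-- The set `Γ(X)` of nonempty closed subsets of `X`, ordered by inclusion. -/
abbrev NonemptyClosed (X : Type*) [TopologicalSpace X] : Type _ :=
  {C : TopologicalSpace.Closeds X // (C : Set X).Nonempty}

/-- The set `Ψ(X) = {↓x : x ∈ X}`; here `↓x` is the closure of `{x}`. -/
def principal (X : Type*) [TopologicalSpace X] : Set (NonemptyClosed X) :=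
  {C | ∃ x : X, (C.1 : Set X) = closure {x}}

/-- The d-closure of a subset `S` of a poset: the least subset containing `S` that is closed under
all existing suprema of nonempty directed subsets. -/
def dClosure {P : Type*} [PartialOrder P] (S : Set P) : Set P :=
  ⋂₀ {T | DirSupClosed T ∧ S ⊆ T}

/-- The closure operator of the d-topology (whose closed sets are the sets that are closed under
directed suprema) is `dClosure`. -/
lemma dClosure_eq_closure {P : Type*} [PartialOrder P] (S : Set P) :
    dClosure S = @closure P (Topology.scottHausdorff P univ) S := by
  let _ : TopologicalSpace P := Topology.scottHausdorff P univ
  simp only [dClosure, closure, Topology.IsScottHausdorff.isClosed_iff_dirSupClosed]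

/-- The D-completion of `X` in its standard representation: the d-closure of `Ψ(X)` in `Γ(X)`. -/
def DCompletion (X : Type*) [TopologicalSpace X] : Set (NonemptyClosed X) :=
  dClosure (principal X)

/-- The set `𝒬(X)` of nonempty compact saturated subsets of `X`; a set is saturated if it is the
intersection of its open neighbourhoods. -/
structure CompactSaturated (X : Type*) [TopologicalSpace X] where
  carrier : Set X
  nonempty : carrier.Nonempty
  isCompact : IsCompact carrier
  saturated : nhdsKer carrier = carrier

/-- `𝒬(X)` is ordered by reverse inclusion. -/
instance : PartialOrder (CompactSaturated X) where
  le K K' := K'.carrier ⊆ K.carrier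
  le_refl _ := Subset.rfl
  le_trans _ _ _ h₁ h₂ := h₂.trans h₁
  le_antisymm K K' h₁ h₂ := by
    cases K; cases K'
    congr 1
    exact Subset.antisymm h₂ h₁

/-- The family `𝓕_K = {↑F : K ⊆ ↑F, F ⊆ X nonempty and finite}`. -/
def family (K : CompactSaturated X) : Set (UpperPowerspace X) := {A | K.carrier ⊆ A.1}

end Space

end DirSpace

namespace DirSpace

/-! ### Closed families in the upper powerspace -/

section General

variable {X : Type*} [TopologicalSpace X]

/-! Each 𝓕_K is closed, because containing `K` passes to limits. In a continuous domain the ↑F that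
are neighbourhoods of `K` form a directed family converging to every ↑G ⊇ K: replacing the points of
`G` by points way below them yields such a neighbourhood. Hence 𝓕_K is the directed supremum of the
closures of these ↑F (`IsContinuousDomain.family_subset_of_isClosed`) and lies in the D-completion.
Conversely, a continuous domain is sober, so its filtered intersections of compact saturated sets
behave well (`exists_carrier_subset_of_biInter_subset`). The directed supremum of sets 𝓕_K is then 𝓕
of the intersection of the `K`, so the sets 𝓕_K already form a d-closed set containing the point
closures. -/

/-- The elements of the upper powerspace containing a fixed nonempty set form a closed set. -/
lemma isClosed_setOf_subset (K : Set X) : IsClosed {A : UpperPowerspace X | K ⊆ A.1} := by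
  refine ⟨fun 𝓕 _ _ F hf hne ⟨n, D, _, hDF, _, hD⟩ hF => ?_⟩
  by_contra hcon
  have hall : ∀ A ∈ 𝓕, K ⊆ A.1 := fun A hA => by
    by_contra h
    exact hcon ⟨A, hA, h⟩
  refine hF fun a ha => ?_
  -- Otherwise pick from every `D i` some `d i` not below `a`; the member of `𝓕` inside the union of
  -- the ↑`d i` then misses `a`.
  have hi : ∃ i, ∀ d ∈ D i, SpecLE d a := by
    by_contra! h
    choose d hd hda using h
    obtain ⟨A, hA, hAd⟩ := hD d hd
    obtain ⟨i, x, rfl, hxa⟩ := mem_iUnion.1 (hAd (hall A hA ha))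
    exact hda i hxa
  obtain ⟨i, hi⟩ := hi
  obtain ⟨x, hxF, hx⟩ := hDF i
  refine ⟨x, hxF, specLE_iff.2 fun U hU hxU => ?_⟩
  obtain ⟨d, hd, hdU⟩ := hx U hU hxU
  exact specLE_iff.1 (hi d hd) U hU hdU

lemma UpperPowerspace.mem_of_le {C : Set (UpperPowerspace X)} (hC : IsClosed C)
    {A B : UpperPowerspace X} (hAB : A ≤ B) (hB : B ∈ C) : A ∈ C := by
  by_contra h
  exact UOpen.mem_of_le hC.isOpen_compl hAB h hB

lemma closure_singleton_upperPowerspace (A : UpperPowerspace X) :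
    closure {A} = {B : UpperPowerspace X | A.1 ⊆ B.1} := by
  refine Subset.antisymm (closure_minimal ?_ (isClosed_setOf_subset A.1)) fun B hB => ?_
  · rintro B rfl
    exact Subset.rfl
  · exact UpperPowerspace.mem_of_le isClosed_closure hB (subset_closure rfl)

lemma mem_of_specLE_of_nhdsKer_eq {K : Set X} (hK : nhdsKer K = K) {x y : X} (hx : x ∈ K)
    (hxy : SpecLE x y) : y ∈ K := by
  rw [← hK, mem_nhdsKer]
  exact fun U hU hKU => specLE_iff.1 hxy U hU (hKU hx)

lemma subset_up (F : Set X) : F ⊆ up F := fun x hx => ⟨x, hx, specLE_refl x⟩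

lemma up_subset_of_isOpen {F U : Set X} (hU : IsOpen U) (hF : F ⊆ U) : up F ⊆ U := by
  rintro y ⟨x, hx, hxy⟩
  exact specLE_iff.1 hxy U hU (hF hx)

/-- The element `↑F` of the upper powerspace, as a compact saturated set. -/
def UpperPowerspace.toCompactSaturated (A : UpperPowerspace X) : CompactSaturated X where
  carrier := A.1
  nonempty := by
    obtain ⟨_, F, -, hne, rfl⟩ := A
    exact hne.mono (subset_up F)
  isCompact := by
    obtain ⟨_, F, hf, -, rfl⟩ := A
    rw [isCompact_iff_finite_subcover]
    intro ι U hU hFU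
    obtain ⟨t, ht⟩ := hf.isCompact.elim_finite_subcover U hU ((subset_up F).trans hFU)
    exact ⟨t, up_subset_of_isOpen (isOpen_biUnion fun i _ => hU i) ht⟩
  saturated := by
    obtain ⟨_, F, -, -, rfl⟩ := A
    refine Subset.antisymm (fun y hy => ?_) subset_nhdsKer
    obtain ⟨x, ⟨z, hz, hzx⟩, hyx⟩ := mem_nhdsKer_iff_specializes.1 hy
    exact ⟨z, hz, specLE_iff.2 fun U hU hzU => hyx.mem_open hU (specLE_iff.1 hzx U hU hzU)⟩

/-! ### Filtered intersections in sober spaces -/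

/-- In a sober space a filtered family of compact saturated sets whose intersection lies in an
open set has a member in that open set. -/
lemma exists_carrier_subset_of_biInter_subset [QuasiSober X] {𝓚 : Set (CompactSaturated X)}
    (hne : 𝓚.Nonempty) (hdir : DirectedOn (· ≤ ·) 𝓚) {U : Set X} (hU : IsOpen U)
    (hsub : ⋂ K ∈ 𝓚, K.carrier ⊆ U) : ∃ K ∈ 𝓚, K.carrier ⊆ U := by
  by_contra! hcon
  -- A minimal closed set outside `U` meeting every `K ∈ 𝓚`; minimality makes it irreducible, and
  -- its generic point will lie in every `K`.
  obtain ⟨M, hMU, hM⟩ := zorn_superset_nonempty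
    {C : Set X | IsClosed C ∧ ∀ K ∈ 𝓚, (K.carrier ∩ C).Nonempty} (by
      intro c hc hchain hcne
      refine ⟨⋂₀ c, ⟨isClosed_sInter fun s hs => (hc hs).1, fun K hK => ?_⟩,
        fun s hs => sInter_subset_of_mem hs⟩
      have := hcne.to_subtype
      rw [sInter_eq_iInter]
      refine K.isCompact.inter_iInter_nonempty _ (fun i => (hc i.2).1) fun u => ?_
      have hchain' : IsChain (· ⊇ ·) c := hchain.symm
      obtain ⟨s, hs⟩ := hchain'.directedOn.directed_val.finset_le u
      exact ((hc s.2).2 K hK).mono (inter_subset_inter_right _ (subset_iInter₂ hs))) Uᶜ ⟨hU.isClosed_compl, fun K hK => by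
        obtain ⟨x, hx, hxU⟩ := not_subset.1 (hcon K hK)
        exact ⟨x, hx, hxU⟩⟩
  have hmeet : ∀ C, IsClosed C → (∀ K ∈ 𝓚, (K.carrier ∩ (M ∩ C)).Nonempty) → M ⊆ C :=
    fun C hC h => (hM.2 ⟨hM.1.1.inter hC, h⟩ inter_subset_left).trans inter_subset_right
  have hirr : IsIrreducible M := by
    obtain ⟨K, hK⟩ := hne
    refine ⟨(hM.1.2 K hK).mono inter_subset_right,
      isPreirreducible_iff_isClosed_union_isClosed.2 fun C₁ C₂ h₁ h₂ hC => ?_⟩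
    by_contra! h
    have h₁' := mt (hmeet C₁ h₁) h.1
    have h₂' := mt (hmeet C₂ h₂) h.2
    push Not at h₁' h₂'
    obtain ⟨K₁, hK₁, e₁⟩ := h₁'
    obtain ⟨K₂, hK₂, e₂⟩ := h₂'
    obtain ⟨K₃, hK₃, h₁₃, h₂₃⟩ := hdir K₁ hK₁ K₂ hK₂
    obtain ⟨x, hx, hxM⟩ := hM.1.2 K₃ hK₃
    rcases hC hxM with hxC | hxC
    · exact eq_empty_iff_forall_notMem.1 e₁ x ⟨h₁₃ hx, hxM, hxC⟩
    · exact eq_empty_iff_forall_notMem.1 e₂ x ⟨h₂₃ hx, hxM, hxC⟩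
  obtain ⟨x, hx⟩ := QuasiSober.sober hirr hM.1.1
  -- Each `K` contains a point of `M`; that point lies below the generic point `x`, so saturation
  -- puts `x` in `K`.
  refine hMU hx.mem (hsub (mem_iInter₂.2 fun K hK => ?_))
  obtain ⟨y, hyK, hyM⟩ := hM.1.2 K hK
  exact mem_of_specLE_of_nhdsKer_eq K.saturated hyK (by rwa [SpecLE, hx.def])

/-- The intersection of a filtered family of compact saturated sets of a sober space. -/
def CompactSaturated.filteredInter [QuasiSober X] (𝓚 : Set (CompactSaturated X))
    (hne : 𝓚.Nonempty) (hdir : DirectedOn (· ≤ ·) 𝓚) : CompactSaturated X where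
  carrier := ⋂ K ∈ 𝓚, K.carrier
  nonempty := by
    by_contra h
    obtain ⟨K, _, hK⟩ := exists_carrier_subset_of_biInter_subset hne hdir isOpen_empty
      (not_nonempty_iff_eq_empty.1 h).subset
    exact K.nonempty.ne_empty (subset_empty_iff.1 hK)
  isCompact := by
    rw [isCompact_iff_finite_subcover]
    intro ι U hU hsub
    obtain ⟨K, hK, hKU⟩ :=
      exists_carrier_subset_of_biInter_subset hne hdir (isOpen_iUnion hU) hsub
    obtain ⟨t, ht⟩ := K.isCompact.elim_finite_subcover U hU hKU
    exact ⟨t, (biInter_subset_of_mem hK).trans ht⟩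
  saturated := by
    refine Subset.antisymm (subset_iInter₂ fun K hK => ?_) subset_nhdsKer
    exact (nhdsKer_mono (biInter_subset_of_mem hK)).trans K.saturated.subset

lemma family_subset_family {K K' : CompactSaturated X} (h : K ≤ K') : family K ⊆ family K' :=
  fun _ hA => Subset.trans h hA

end General

/-! ### Continuous domains -/

section Domain

variable {X : Type*} [PartialOrder X]

lemma WayBelow.le {x y : X} (h : WayBelow x y) : x ≤ y := by
  obtain ⟨d, rfl, hd⟩ := h {y} (singleton_nonempty y)
    (by rintro a rfl b rfl; exact ⟨_, rfl, le_rfl, le_rfl⟩) y isLUB_singleton le_rfl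
  exact hd

lemma WayBelow.trans_le {x y z : X} (h : WayBelow x y) (hyz : y ≤ z) : WayBelow x z :=
  fun D hne hD a ha hza => h D hne hD a ha (hyz.trans hza)

variable [TopologicalSpace X] [Topology.IsScott X univ]

lemma specLE_iff_le {x y : X} : SpecLE x y ↔ x ≤ y := by
  rw [SpecLE, Topology.IsScott.closure_singleton, mem_Iic]

/-- Interpolation: the elements way below some member of `D` form a directed set with the same
supremum as `D`. -/
lemma IsContinuousDomain.isOpen_setOf_wayBelow (hX : IsContinuousDomain X) (x : X) :
    IsOpen {y | WayBelow x y} := by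
  rw [Topology.IsScott.isOpen_iff_isUpperSet_and_dirSupInaccOn (D := univ)]
  refine ⟨fun y z hyz hy => hy.trans_le hyz, fun D _ hne hD a ha hxa => ?_⟩
  obtain ⟨e, ⟨d, hd, hed⟩, hxe⟩ := hxa {z | ∃ d ∈ D, WayBelow z d}
    (by
      obtain ⟨d, hd⟩ := hne
      obtain ⟨z, hz⟩ := hX.nonempty d
      exact ⟨z, d, hd, hz⟩)
    (by
      rintro z₁ ⟨d₁, hd₁, h₁⟩ z₂ ⟨d₂, hd₂, h₂⟩
      obtain ⟨d, hd, h₁d, h₂d⟩ := hD d₁ hd₁ d₂ hd₂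
      obtain ⟨z, hz, h⟩ := hX.directedOn d z₁ (h₁.trans_le h₁d) z₂ (h₂.trans_le h₂d)
      exact ⟨z, ⟨d, hd, hz⟩, h⟩)
    a
    ⟨by
      rintro z ⟨d, hd, hz⟩
      exact hz.le.trans (ha.1 hd),
    fun b hb => ha.2 fun d hd => (hX.isLUB d).2 fun z hz => hb ⟨d, hd, hz⟩⟩ le_rfl
  refine ⟨d, hd, fun E hEne hE b hb hdb => ?_⟩
  obtain ⟨w, hw, hew⟩ := hed E hEne hE b hb hdb
  exact ⟨w, hw, hxe.trans hew⟩

lemma IsContinuousDomain.exists_wayBelow_mem (hX : IsContinuousDomain X) {U : Set X}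
    (hU : IsOpen U) {x : X} (hx : x ∈ U) : ∃ y ∈ U, WayBelow y x := by
  obtain ⟨y, hy, hyU⟩ := ((Topology.IsScott.isOpen_iff_isUpperSet_and_dirSupInaccOn
    (D := univ)).1 hU).2 (mem_univ _) (hX.nonempty x) (hX.directedOn x) (hX.isLUB x) hx
  exact ⟨y, hyU, hy⟩

/-- The generic point is the supremum of all elements way below some point of `M`; irreducibility
makes them directed. -/
lemma IsContinuousDomain.quasiSober (hX : IsContinuousDomain X) : QuasiSober X := by
  refine ⟨fun {M} hirr hM => ?_⟩
  have hlow := Topology.IsScott.isLowerSet_of_isClosed hM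
  set D : Set X := {d | ∃ m ∈ M, WayBelow d m}
  have hDne : D.Nonempty := by
    obtain ⟨m, hm⟩ := hirr.1
    obtain ⟨d, hd⟩ := hX.nonempty m
    exact ⟨d, m, hm, hd⟩
  have hDdir : DirectedOn (· ≤ ·) D := by
    rintro d₁ ⟨m₁, hm₁, h₁⟩ d₂ ⟨m₂, hm₂, h₂⟩
    obtain ⟨m, hm, h₁m, h₂m⟩ := hirr.2 _ _ (hX.isOpen_setOf_wayBelow d₁)
      (hX.isOpen_setOf_wayBelow d₂) ⟨m₁, hm₁, h₁⟩ ⟨m₂, hm₂, h₂⟩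
    obtain ⟨d, hd, h⟩ := hX.directedOn m d₁ h₁m d₂ h₂m
    exact ⟨d, ⟨m, hm, hd⟩, h⟩
  obtain ⟨x, hx⟩ := hX.isDcpo D hDne hDdir
  have hDM : D ⊆ M := by
    rintro d ⟨m, hm, hd⟩
    exact hlow hd.le hm
  have hxM : x ∈ M := Topology.IsScott.dirSupClosed_of_isClosed hM hDM hDne hDdir hx
  refine ⟨x, ?_⟩
  rw [IsGenericPoint, Topology.IsScott.closure_singleton]
  refine Subset.antisymm (fun y hy => hlow hy hxM) fun m hm => ?_
  exact (hX.isLUB m).2 fun d hd => hx.1 ⟨m, hm, hd⟩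

/-- Compact sets of a continuous domain have a neighbourhood base of finitely generated upper
sets. -/
lemma IsContinuousDomain.exists_upperPowerspace_subset (hX : IsContinuousDomain X) {K U : Set X}
    (hK : IsCompact K) (hne : K.Nonempty) (hU : IsOpen U) (hKU : K ⊆ U) :
    ∃ A : UpperPowerspace X, K ⊆ interior A.1 ∧ A.1 ⊆ U := by
  obtain ⟨t, ht⟩ := hK.elim_finite_subcover (fun x : U => {y | WayBelow x.1 y})
    (fun x => hX.isOpen_setOf_wayBelow x.1) fun k hk => by
      obtain ⟨y, hyU, hy⟩ := hX.exists_wayBelow_mem hU (hKU hk)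
      exact mem_iUnion.2 ⟨⟨y, hyU⟩, hy⟩
  have htne : (Subtype.val '' (t : Set U)).Nonempty := by
    obtain ⟨k, hk⟩ := hne
    obtain ⟨x, hx, -⟩ := mem_iUnion₂.1 (ht hk)
    exact ⟨x, x, hx, rfl⟩
  refine ⟨upElt _ (t.finite_toSet.image _) htne, ?_, up_subset_of_isOpen hU (by
    rintro _ ⟨x, -, rfl⟩
    exact x.2)⟩
  refine ht.trans (interior_maximal (iUnion₂_subset fun x hx y hy => ?_)
    (isOpen_biUnion fun x _ => hX.isOpen_setOf_wayBelow x.1))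
  exact ⟨x, ⟨x, hx, rfl⟩, specLE_iff_le.2 (WayBelow.le hy)⟩

lemma IsContinuousDomain.directedOn_subset_interior (hX : IsContinuousDomain X)
    (K : CompactSaturated X) :
    DirectedOn (· ≤ ·) {A : UpperPowerspace X | K.carrier ⊆ interior A.1} := by
  intro A hA B hB
  obtain ⟨C, hKC, hC⟩ := hX.exists_upperPowerspace_subset K.isCompact K.nonempty
    (isOpen_interior.inter isOpen_interior) (subset_inter hA hB)
  exact ⟨C, hKC, fun x hx => interior_subset (hC hx).1, fun x hx => interior_subset (hC hx).2⟩

lemma IsContinuousDomain.nonempty_subset_interior (hX : IsContinuousDomain X)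
    (K : CompactSaturated X) :
    {A : UpperPowerspace X | K.carrier ⊆ interior A.1}.Nonempty := by
  obtain ⟨A, hA, -⟩ := hX.exists_upperPowerspace_subset K.isCompact K.nonempty isOpen_univ
    (subset_univ _)
  exact ⟨A, hA⟩

/-- `𝓕_K` is contained in every closed set containing all `↑F` that are neighbourhoods of `K`. -/
lemma IsContinuousDomain.family_subset_of_isClosed (hX : IsContinuousDomain X)
    (K : CompactSaturated X) {C : Set (UpperPowerspace X)} (hC : IsClosed C)
    (h : ∀ A : UpperPowerspace X, K.carrier ⊆ interior A.1 → A ∈ C) : family K ⊆ C := by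
  rintro ⟨_, G, hf, hne, rfl⟩ hKG
  by_contra hGC
  have := hf.to_subtype
  obtain ⟨n, ⟨e⟩⟩ := Finite.exists_equiv_fin G
  -- The witnesses are the way-below sets of the points of `G`.
  have hconv : UConv {A : UpperPowerspace X | K.carrier ⊆ interior A.1} G := by
    have hlim : ∀ x : X, x ∈ dlim {y | WayBelow y x} := fun x U hU hxU => by
      obtain ⟨y, hyU, hy⟩ := hX.exists_wayBelow_mem hU hxU
      exact ⟨y, hy, hyU⟩
    refine ⟨n, fun i => {y | WayBelow y (e.symm i).1}, fun i => ⟨hX.nonempty _, ?_⟩,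
      fun i => ⟨_, (e.symm i).2, hlim _⟩, fun x hx => mem_iUnion.2 ⟨e ⟨x, hx⟩, ?_⟩,
      fun d hd => ?_⟩
    · intro a ha b hb
      obtain ⟨c, hc, hac, hbc⟩ := hX.directedOn _ a ha b hb
      exact ⟨c, hc, specLE_iff_le.2 hac, specLE_iff_le.2 hbc⟩
    · simpa using hlim x
    · have : Nonempty (Fin n) := ⟨e ⟨_, hne.some_mem⟩⟩
      refine ⟨upElt (range d) (finite_range d) (range_nonempty d), ?_, ?_⟩
      · refine Subset.trans (fun k hk => ?_) (interior_maximal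
          (iUnion_subset fun i y hy => ⟨d i, mem_range_self i, specLE_iff_le.2 (WayBelow.le hy)⟩)
          (isOpen_iUnion fun i => hX.isOpen_setOf_wayBelow (d i)))
        obtain ⟨x, hx, hxk⟩ := hKG hk
        refine mem_iUnion.2 ⟨e ⟨x, hx⟩, ?_⟩
        have := hd (e ⟨x, hx⟩)
        simp only [Equiv.symm_apply_apply] at this
        exact WayBelow.trans_le this (specLE_iff_le.1 hxk)
      · rintro y ⟨_, ⟨i, rfl⟩, hy⟩
        exact mem_iUnion.2 ⟨i, d i, rfl, hy⟩
  obtain ⟨A, hA, hAC⟩ := hC.isOpen_compl _ (hX.nonempty_subset_interior K)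
    (hX.directedOn_subset_interior K) G hf hne hconv hGC
  exact hAC (h A hA)

/-! ### The isomorphism onto the D-completion -/

/-- `𝓕_K` as a nonempty closed subset of the upper powerspace. -/
def IsContinuousDomain.closedFamily (hX : IsContinuousDomain X) (K : CompactSaturated X) :
    NonemptyClosed (UpperPowerspace X) :=
  ⟨⟨family K, isClosed_setOf_subset K.carrier⟩,
    (hX.nonempty_subset_interior K).mono fun _ hA => Subset.trans hA interior_subset⟩

/-- Order is reflected because a saturated `K` is the intersection of its open neighbourhoods, each
of which contains a member of 𝓕_K. -/
lemma IsContinuousDomain.closedFamily_le_iff (hX : IsContinuousDomain X)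
    {K K' : CompactSaturated X} : hX.closedFamily K ≤ hX.closedFamily K' ↔ K ≤ K' := by
  refine ⟨fun h => ?_, fun h => family_subset_family h⟩
  change K'.carrier ⊆ K.carrier
  rw [← K.saturated, subset_nhdsKer_iff]
  intro U hU hKU
  obtain ⟨A, hKA, hAU⟩ := hX.exists_upperPowerspace_subset K.isCompact K.nonempty hU hKU
  have hA : A ∈ family K' := h (show A ∈ family K from Subset.trans hKA interior_subset)
  exact Subset.trans hA hAU

lemma IsContinuousDomain.closedFamily_mem_dCompletion (hX : IsContinuousDomain X)
    (K : CompactSaturated X) : hX.closedFamily K ∈ DCompletion (UpperPowerspace X) := by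
  rintro T ⟨hT, hΨ⟩
  refine hT (d := (fun A : UpperPowerspace X => hX.closedFamily A.toCompactSaturated) ''
    {A | K.carrier ⊆ interior A.1}) ?_ ((hX.nonempty_subset_interior K).image _) ?_ ⟨?_, ?_⟩
  · rintro _ ⟨A, -, rfl⟩
    exact hΨ ⟨A, (closure_singleton_upperPowerspace A).symm⟩
  · rintro _ ⟨A, hA, rfl⟩ _ ⟨B, hB, rfl⟩
    obtain ⟨C, hC, hAC, hBC⟩ := hX.directedOn_subset_interior K A hA B hB
    exact ⟨_, ⟨C, hC, rfl⟩, hX.closedFamily_le_iff.2 hAC, hX.closedFamily_le_iff.2 hBC⟩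
  · rintro _ ⟨A, hA, rfl⟩
    exact hX.closedFamily_le_iff.2 (Subset.trans hA interior_subset)
  · intro C hC
    refine hX.family_subset_of_isClosed K C.1.isClosed fun A hA => ?_
    exact hC ⟨A, hA, rfl⟩ (show A ∈ family A.toCompactSaturated from Subset.rfl)

lemma IsContinuousDomain.exists_eq_closedFamily (hX : IsContinuousDomain X)
    {C : NonemptyClosed (UpperPowerspace X)} (hC : C ∈ DCompletion (UpperPowerspace X)) :
    ∃ K, hX.closedFamily K = C := by
  have := hX.quasiSober
  refine hC (range hX.closedFamily) ⟨?_, ?_⟩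
  · intro d hd hne hdir C hC
    have himg : hX.closedFamily '' (hX.closedFamily ⁻¹' d) = d := image_preimage_eq_of_subset hd
    set 𝓚 := hX.closedFamily ⁻¹' d
    have h𝓚 : 𝓚.Nonempty := by rwa [← himg, image_nonempty] at hne
    have h𝓚dir : DirectedOn (· ≤ ·) 𝓚 := by
      intro K₁ h₁ K₂ h₂
      obtain ⟨D, hD, h₁D, h₂D⟩ := hdir _ h₁ _ h₂
      obtain ⟨K, rfl⟩ := hd hD
      exact ⟨K, hD, hX.closedFamily_le_iff.1 h₁D, hX.closedFamily_le_iff.1 h₂D⟩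
    refine ⟨CompactSaturated.filteredInter 𝓚 h𝓚 h𝓚dir, IsLUB.unique ⟨?_, ?_⟩ hC⟩
    · rintro D hD
      obtain ⟨K, rfl⟩ := hd hD
      exact hX.closedFamily_le_iff.2 (biInter_subset_of_mem (show K ∈ 𝓚 from hD))
    · intro B hB
      -- It suffices to treat neighbourhoods of the intersection, and each of these already contains
      -- some `K ∈ 𝓚`.
      refine hX.family_subset_of_isClosed _ B.1.isClosed fun A hA => ?_
      obtain ⟨K, hK, hKA⟩ :=
        exists_carrier_subset_of_biInter_subset h𝓚 h𝓚dir isOpen_interior hA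
      exact hB hK (show A ∈ family K from hKA.trans interior_subset)
  · rintro C ⟨A, hA⟩
    refine ⟨A.toCompactSaturated, Subtype.ext (TopologicalSpace.Closeds.ext ?_)⟩
    rw [hA, closure_singleton_upperPowerspace]
    rfl

/-- The order isomorphism `K ↦ 𝓕_K` from `𝒬(X)` onto the D-completion of the upper powerspace. -/
noncomputable def IsContinuousDomain.familyIso (hX : IsContinuousDomain X) :
    CompactSaturated X ≃o DCompletion (UpperPowerspace X) :=
  RelIso.ofSurjective
    (OrderEmbedding.ofMapLEIff
      (fun K => (⟨hX.closedFamily K, hX.closedFamily_mem_dCompletion K⟩ :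
        DCompletion (UpperPowerspace X)))
      fun _ _ => hX.closedFamily_le_iff)
    fun C => (hX.exists_eq_closedFamily C.2).imp fun _ h => Subtype.ext h

end Domain

end DirSpace

theorem mainTheorem3 {L : Type*} [PartialOrder L] (hL : DirSpace.IsContinuousDomain L) :
    -- As sets of subsets of the upper powerspace of `ΣL`, the D-completion and `{𝓕_K}` are equal.
    ({S : Set (DirSpace.UpperPowerspace (Topology.WithScott L)) |
        ∃ A ∈ DirSpace.DCompletion (DirSpace.UpperPowerspace (Topology.WithScott L)),
          (A.1 : Set (DirSpace.UpperPowerspace (Topology.WithScott L))) = S} =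
      {S | ∃ K : DirSpace.CompactSaturated (Topology.WithScott L), S = DirSpace.family K}) ∧
    -- `K ↦ 𝓕_K` is an isomorphism from `𝒬(L)` (reverse inclusion) to the D-completion (inclusion).
    ∃ e : DirSpace.CompactSaturated (Topology.WithScott L) ≃o
        DirSpace.DCompletion (DirSpace.UpperPowerspace (Topology.WithScott L)),
      ∀ K, ((e K).1.1 : Set (DirSpace.UpperPowerspace (Topology.WithScott L))) =
        DirSpace.family K := by
  let _ : PartialOrder (Topology.WithScott L) := ‹PartialOrder L›
  have hX : DirSpace.IsContinuousDomain (Topology.WithScott L) := hL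
  have : Topology.IsScott (Topology.WithScott L) univ := ⟨rfl⟩
  refine ⟨Set.ext fun S => ⟨?_, ?_⟩, hX.familyIso, fun K => rfl⟩
  · rintro ⟨A, hA, rfl⟩
    obtain ⟨K, rfl⟩ := hX.exists_eq_closedFamily hA
    exact ⟨K, rfl⟩
  · rintro ⟨K, rfl⟩
    exact ⟨hX.closedFamily K, hX.closedFamily_mem_dCompletion K, rfl⟩
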